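/- Let $M$ be a smooth (Hausdorff) manifold without boundary with an almost Hermitian structure $(g,J)$, i.e. a smooth Riemannian metric $g$ and a smooth field $J$ of endomorphisms of $TM$ with $J^2=-1$ and $g(JX,JY)=g(X,Y)$. Let $\nabla$ be the Levi-Civita connection of $g$, let $R(X,Y)=-[\nabla_X,\nabla_Y]+\nabla_{[X,Y]}$ be its curvature and $R(X,Y,Z,U)=g(R(X,Y)Z,U)$. Let $$\eta_XY=\tfrac12(\nabla_XJ)JY,\qquad \overline\nabla_XY=\nabla_XY+\eta_XY$$ be the intrinsic torsion and the (first) canonical Hermitian connection, and let $T_XY$ be the torsion tensor of $\overline\nabla$, so that $T_XY=\eta_XY-\eta_YX$. For a tangent vector $V$, $\overline\nabla_V\eta=0$ means that $\overline\nabla_V(\eta_YZ)-\eta_{\overline\nabla_VY}Z-\eta_Y(\overline\nabla_VZ)=0$ for all smooth vector fields $Y,Z$. The structure is quasi-Kähler if $(\nabla_{JX}J)JY=-(\nabla_XJ)Y$ for all $X,Y$; almost Kähler if the form $\omega=g(J\cdot,\cdot)$ is closed; and in the class $\mathcal{AH}_3$ if $R(JX,JY,JZ,JU)=R(X,Y,Z,U)$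 for all $X,Y,Z,U$. Proposition 3.2. 1. If $(M,g,J)$ is quasi-Kähler and in the class $\mathcal{AH}_3$, then $\overline\nabla_{T_XY}\,\eta=0$ for all $x\in M$ and all $X,Y\in T_xM$. 2. Suppose $(M,g,J)$ is almost Kähler. For $x\in M$ let $H_x=\{v\in T_xM:\eta_v=0\}$ be the Kähler nullity and $\mathcal V_x$ the orthogonal complement of $H_x$ in $T_xM$. Then, at each $x\in M$, one has $\overline\nabla_{T_XY}\,\eta=0$ for all $X,Y\in T_xM$ if and only if $\overline\nabla_V\eta=0$ for all $V\in\mathcal V_x$. 3. Hence, if $(M,g,J)$ is almost Kähler and in the class $\mathcal{AH}_3$, then $\overline\nabla_V\eta=0$ for all $x\in M$ and all $V\in\mathcal V_x$. -/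

import Mathlib

open Bundle
open scoped Manifold ContDiff

noncomputable section

/-! A vector field on `M` is a function `X : (x : M) → TangentSpace I x`, and `T% X` is the
corresponding map into the tangent bundle. `d% f x v` is the derivative of the function `f` at `x`
in the direction `v`. For a covariant derivative `cov`, `cov Y x v` is `∇_v Y` at `x`. -/

namespace AlmostHermitian

variable {E : Type*} [NormedAddCommGroup E] [NormedSpace ℝ E]
  {H : Type*} [TopologicalSpace H] {I : ModelWithCorners ℝ E H}
  {M : Type*} [TopologicalSpace M] [ChartedSpace H M] [IsManifold I ∞ M]

variable (I M) in
/-- Smooth Riemannian metrics on `M`; the inner product at `x` is `g.inner x`. -/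
abbrev RiemMetric :=
  ContMDiffRiemannianMetric I ∞ E (TangentSpace I : M → Type _)

/-! ### The Levi-Civita connection -/

namespace RiemMetric

variable (g : RiemMetric I M)

theorem mdifferentiableAt_inner {x : M} {X Y : (x : M) → TangentSpace I x}
    (hX : MDiffAt (T% X) x) (hY : MDiffAt (T% Y) x) :
    MDiffAt (fun y ↦ g.inner y (X y) (Y y)) x := by
  have h : MDifferentiableAt I (I.prod 𝓘(ℝ))
      (fun m ↦ TotalSpace.mk' ℝ (E := Bundle.Trivial M ℝ) m (g.inner m (X m) (Y m))) x :=
    MDifferentiableAt.clm_bundle_apply₂ (F₁ := E) (F₂ := E)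
      (g.contMDiff.mdifferentiableAt (by simp)) hX hY
  simp only [mdifferentiableAt_totalSpace] at h
  exact h.2

/-- The right-hand side of the Koszul formula for `2 g(∇_V S, U)` at the point `x`. -/
def koszul (V S U : (x : M) → TangentSpace I x) (x : M) : ℝ :=
  d% (fun y ↦ g.inner y (S y) (U y)) x (V x)
    + d% (fun y ↦ g.inner y (V y) (U y)) x (S x)
    - d% (fun y ↦ g.inner y (V y) (S y)) x (U x)
    + g.inner x (VectorField.mlieBracket I V S x) (U x)
    - g.inner x (VectorField.mlieBracket I V U x) (S x)
    - g.inner x (VectorField.mlieBracket I S U x) (V x)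

variable [FiniteDimensional ℝ E]

theorem koszul_tensorial_left {x : M} {S U : (x : M) → TangentSpace I x}
    (hS : MDiffAt (T% S) x) (hU : MDiffAt (T% U) x) :
    TensorialAt I E (fun V : (x : M) → TangentSpace I x ↦ g.koszul V S U x) x where
  smul hf hV := by
    simp [koszul, mvfderiv_fun_mul hf (g.mdifferentiableAt_inner hV hU),
      mvfderiv_fun_mul hf (g.mdifferentiableAt_inner hV hS),
      VectorField.mlieBracket_smul_left hf hV]
    ring
  add hV hV' := by
    simp [koszul,
      mvfderiv_fun_add (g.mdifferentiableAt_inner hV hU) (g.mdifferentiableAt_inner hV' hU),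
      mvfderiv_fun_add (g.mdifferentiableAt_inner hV hS) (g.mdifferentiableAt_inner hV' hS),
      VectorField.mlieBracket_add_left hV hV']
    ring

theorem koszul_tensorial_right {x : M} {V S : (x : M) → TangentSpace I x}
    (hV : MDiffAt (T% V) x) (hS : MDiffAt (T% S) x) :
    TensorialAt I E (fun U : (x : M) → TangentSpace I x ↦ g.koszul V S U x) x where
  smul {f U} hf hU := by
    simp [koszul, mvfderiv_fun_mul hf (g.mdifferentiableAt_inner hS hU),
      mvfderiv_fun_mul hf (g.mdifferentiableAt_inner hV hU),
      VectorField.mlieBracket_smul_right hf hU]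
    rw [g.symm x (U x) (S x), g.symm x (U x) (V x)]
    ring
  add hU hU' := by
    simp [koszul,
      mvfderiv_fun_add (g.mdifferentiableAt_inner hS hU) (g.mdifferentiableAt_inner hS hU'),
      mvfderiv_fun_add (g.mdifferentiableAt_inner hV hU) (g.mdifferentiableAt_inner hV hU'),
      VectorField.mlieBracket_add_right hU hU']
    ring

/-- The isomorphism of the tangent space at `x` with its dual given by the metric. -/
def flat (x : M) : TangentSpace I x ≃ₗ[ℝ] (TangentSpace I x →L[ℝ] ℝ) :=
  haveI : FiniteDimensional ℝ (TangentSpace I x) := inferInstanceAs (FiniteDimensional ℝ E)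
  haveI : FiniteDimensional ℝ (TangentSpace I x →L[ℝ] ℝ) :=
    inferInstanceAs (FiniteDimensional ℝ (E →L[ℝ] ℝ))
  LinearEquiv.ofInjectiveOfFinrankEq (g.inner x).toLinearMap
    (by
      refine (injective_iff_map_eq_zero _).2 fun v hv ↦ ?_
      by_contra hne
      have := g.pos x v hne
      simp_all)
    (by
      change Module.finrank ℝ E = Module.finrank ℝ (E →L[ℝ] ℝ)
      rw [← (LinearMap.toContinuousLinearMap (𝕜 := ℝ) (E := E) (F' := ℝ)).finrank_eq]
      exact Subspace.dual_finrank_eq.symm)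

@[simp] theorem flat_apply (x : M) (v u : TangentSpace I x) : g.flat x v u = g.inner x v u := rfl

open scoped Classical in
/-- The covariant derivative `v ↦ ∇_v S` at `x`, defined by the Koszul formula
`2 g(∇_V S, U) = koszul V S U`. -/
def leviCivitaFun (S : (x : M) → TangentSpace I x) (x : M) :
    TangentSpace I x →L[ℝ] TangentSpace I x :=
  haveI : FiniteDimensional ℝ (TangentSpace I x) := inferInstanceAs (FiniteDimensional ℝ E)
  haveI : T2Space (TangentSpace I x) := inferInstanceAs (T2Space E)
  if hS : MDiffAt (T% S) x then
    LinearMap.toContinuousLinearMap ((1 / 2 : ℝ) • ((g.flat x).symm.toLinearMap ∘ₗ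
      (TensorialAt.mkHom₂ (fun V U : (x : M) → TangentSpace I x ↦ g.koszul V S U x) x
        (fun _ hU ↦ g.koszul_tensorial_left hS hU)
        (fun _ hV ↦ g.koszul_tensorial_right hV hS)).toLinearMap))
  else 0

theorem two_inner_leviCivitaFun {x : M} {V S U : (x : M) → TangentSpace I x}
    (hV : MDiffAt (T% V) x) (hS : MDiffAt (T% S) x) (hU : MDiffAt (T% U) x) :
    2 * g.inner x (g.leviCivitaFun S x (V x)) (U x) = g.koszul V S U x := by
  have key : ∀ A : TangentSpace I x →L[ℝ] ℝ, ∀ u, g.inner x ((g.flat x).symm A) u = A u := by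
    intro A u
    rw [← flat_apply, LinearEquiv.apply_symm_apply]
  simp [leviCivitaFun, hS, key, TensorialAt.mkHom₂_apply _ _ hV hU]

theorem ext_inner {x : M} {A B : TangentSpace I x →L[ℝ] TangentSpace I x}
    (h : ∀ V U : (x : M) → TangentSpace I x, MDiffAt (T% V) x → MDiffAt (T% U) x →
      g.inner x (A (V x)) (U x) = g.inner x (B (V x)) (U x)) : A = B := by
  ext v
  apply (g.flat x).injective
  ext u
  simpa using h (FiberBundle.extend E v) (FiberBundle.extend E u)
    (FiberBundle.mdifferentiableAt_extend ..) (FiberBundle.mdifferentiableAt_extend ..)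

/-- The Levi-Civita connection of `g`. -/
def leviCivita : CovariantDerivative I E (TangentSpace I : M → Type _) where
  toFun := g.leviCivitaFun
  isCovariantDerivativeOnUniv :=
    { add := fun {S S' x} hS hS' _ ↦ by
        refine g.ext_inner fun V U hV hU ↦ ?_
        have hSS' : MDiffAt (T% (S + S')) x := mdifferentiableAt_add_section hS hS'
        have h1 := g.two_inner_leviCivitaFun hV hSS' hU
        have h2 := g.two_inner_leviCivitaFun hV hS hU
        have h3 := g.two_inner_leviCivitaFun hV hS' hU
        simp [koszul,
          mvfderiv_fun_add (g.mdifferentiableAt_inner hS hU) (g.mdifferentiableAt_inner hS' hU),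
          mvfderiv_fun_add (g.mdifferentiableAt_inner hV hS) (g.mdifferentiableAt_inner hV hS'),
          VectorField.mlieBracket_add_right hS hS',
          VectorField.mlieBracket_add_left hS hS'] at h1 h2 h3 ⊢
        linarith
      leibniz := fun {S f x} hS hf _ ↦ by
        refine g.ext_inner fun V U hV hU ↦ ?_
        have hfS : MDiffAt (T% (f • S)) x := hf.smul_section hS
        have h1 := g.two_inner_leviCivitaFun hV hfS hU
        have h2 := g.two_inner_leviCivitaFun hV hS hU
        simp [koszul,
          mvfderiv_fun_mul hf (g.mdifferentiableAt_inner hS hU),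
          mvfderiv_fun_mul hf (g.mdifferentiableAt_inner hV hS),
          VectorField.mlieBracket_smul_right hf hS,
          VectorField.mlieBracket_smul_left hf hS] at h1 h2 ⊢
        rw [g.symm x (S x) (V x)] at h1
        linear_combination (1 / 2 : ℝ) * h1 + (-1 / 2 : ℝ) * f x * h2 }

/-- The Levi-Civita connection is metric. -/
theorem leviCivita_metric {x : M} {X Y : (x : M) → TangentSpace I x}
    (hX : MDiffAt (T% X) x) (hY : MDiffAt (T% Y) x) (v : TangentSpace I x) :
    d% (fun y ↦ g.inner y (X y) (Y y)) x v =
      g.inner x (g.leviCivita X x v) (Y x) + g.inner x (X x) (g.leviCivita Y x v) := by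
  have hV := FiberBundle.mdifferentiableAt_extend I E v
  have h1 := g.two_inner_leviCivitaFun hV hX hY
  have h2 := g.two_inner_leviCivitaFun hV hY hX
  have e : (fun y ↦ g.inner y (Y y) (X y)) = fun y ↦ g.inner y (X y) (Y y) :=
    funext fun y ↦ g.symm y _ _
  have s := VectorField.mlieBracket_swap_apply (I := I) (V := X) (W := Y) (x := x)
  simp only [koszul, FiberBundle.extend_apply_self, e, s] at h1 h2
  simp only [map_neg, neg_apply] at h1 h2
  change _ = g.inner x (g.leviCivitaFun X x v) (Y x) + g.inner x (X x) (g.leviCivitaFun Y x v)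
  rw [g.symm x (X x)]
  linarith

/-- The Levi-Civita connection is torsion-free. -/
theorem leviCivita_torsion : g.leviCivita.torsion = 0 := by
  rw [CovariantDerivative.torsion_eq_zero_iff]
  intro X Y x hX hY
  apply (g.flat x).injective
  ext u
  have hU := FiberBundle.mdifferentiableAt_extend I E u
  have h1 := g.two_inner_leviCivitaFun hX hY hU
  have h2 := g.two_inner_leviCivitaFun hY hX hU
  have e : (fun y ↦ g.inner y (Y y) (X y)) = fun y ↦ g.inner y (X y) (Y y) :=
    funext fun y ↦ g.symm y _ _
  have s := VectorField.mlieBracket_swap_apply (I := I) (V := Y) (W := X) (x := x)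
  simp only [koszul, FiberBundle.extend_apply_self, e, s] at h1 h2
  simp only [map_neg, neg_apply] at h1 h2
  simp only [flat_apply, map_sub, sub_apply]
  change g.inner x (g.leviCivitaFun Y x (X x)) u - g.inner x (g.leviCivitaFun X x (Y x)) u = _
  linarith

/-- The curvature `R(X, Y)Z = -[∇_X, ∇_Y]Z + ∇_{[X, Y]}Z` of the Levi-Civita connection. -/
def curvature (X Y Z : (x : M) → TangentSpace I x) (x : M) : TangentSpace I x :=
  -(g.leviCivita (fun y ↦ g.leviCivita Z y (Y y)) x (X x)
      - g.leviCivita (fun y ↦ g.leviCivita Z y (X y)) x (Y x))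
    + g.leviCivita Z x (VectorField.mlieBracket I X Y x)

end RiemMetric

/-! ### Almost Hermitian structures -/

/-- An orthogonal almost complex structure `J` for the Riemannian metric `g`: a smooth field of
endomorphisms of the tangent spaces with `J² = -1` and `g(JX, JY) = g(X, Y)`. -/
structure AlmostComplex (g : RiemMetric I M) where
  J : (x : M) → TangentSpace I x →L[ℝ] TangentSpace I x
  smooth : ContMDiff I (I.prod 𝓘(ℝ, E →L[ℝ] E)) ∞
    (fun x ↦ TotalSpace.mk' (E →L[ℝ] E) (E := fun x : M ↦ TangentSpace I x →L[ℝ] TangentSpace I x)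
      x (J x))
  sq : ∀ (x : M) (v : TangentSpace I x), J x (J x v) = -v
  isometry : ∀ (x : M) (v w : TangentSpace I x), g.inner x (J x v) (J x w) = g.inner x v w

namespace AlmostComplex

variable {g : RiemMetric I M} (A : AlmostComplex g)

theorem mdifferentiableAt_J {x : M} {Y : (x : M) → TangentSpace I x} (hY : MDiffAt (T% Y) x) :
    MDiffAt (T% (fun y ↦ A.J y (Y y))) x :=
  MDifferentiableAt.clm_bundle_apply (F₁ := E) (F₂ := E)
    (A.smooth.mdifferentiableAt (by simp)) hY

variable [FiniteDimensional ℝ E]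

theorem nablaJ_tensorial (x : M) :
    TensorialAt I E (fun Y : (x : M) → TangentSpace I x ↦
      g.leviCivita (fun y ↦ A.J y (Y y)) x - (A.J x).comp (g.leviCivita Y x)) x where
  smul {f Y} hf hY := by
    have h1 := g.leviCivita.isCovariantDerivativeOn.leibniz hY hf (Set.mem_univ x)
    have h2 := g.leviCivita.isCovariantDerivativeOn.leibniz (A.mdifferentiableAt_J hY) hf
      (Set.mem_univ x)
    have e : (fun y ↦ A.J y ((f • Y) y)) = f • fun y ↦ A.J y (Y y) := by
      ext y; simp
    ext v
    rw [e, h1, h2]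
    simp
    module
  add {Y Y'} hY hY' := by
    have h1 := g.leviCivita.isCovariantDerivativeOn.add hY hY' (Set.mem_univ x)
    have h2 := g.leviCivita.isCovariantDerivativeOn.add (A.mdifferentiableAt_J hY)
      (A.mdifferentiableAt_J hY') (Set.mem_univ x)
    have e : (fun y ↦ A.J y ((Y + Y') y)) = (fun y ↦ A.J y (Y y)) + fun y ↦ A.J y (Y' y) := by
      ext y; simp
    ext v
    rw [e, h1, h2]
    simp
    abel

/-- The covariant derivative of `J` for the Levi-Civita connection, `(∇_v J)w`, with the
arguments in the order `A.nablaJ x w v`; for a vector field `Y` it is `∇_v(JY) - J ∇_v Y`. -/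
def nablaJ (x : M) : TangentSpace I x →L[ℝ] TangentSpace I x →L[ℝ] TangentSpace I x :=
  TensorialAt.mkHom _ x (A.nablaJ_tensorial x)

theorem nablaJ_apply {x : M} {Y : (x : M) → TangentSpace I x} (hY : MDiffAt (T% Y) x)
    (v : TangentSpace I x) :
    A.nablaJ x (Y x) v =
      g.leviCivita (fun y ↦ A.J y (Y y)) x v - A.J x (g.leviCivita Y x v) := by
  rw [nablaJ, TensorialAt.mkHom_apply (A.nablaJ_tensorial x) hY]
  rfl

/-- The intrinsic torsion `η_v w = ½ (∇_v J)(J w)`, as a one-form with values in endomorphisms,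
with the arguments in the order `A.etaForm x w v`. -/
def etaForm (x : M) : TangentSpace I x →L[ℝ] TangentSpace I x →L[ℝ] TangentSpace I x :=
  (1 / 2 : ℝ) • (A.nablaJ x).comp (A.J x)

/-- The intrinsic torsion `η_v w = ½ (∇_v J)(J w)`. -/
def eta (x : M) (v w : TangentSpace I x) : TangentSpace I x := A.etaForm x w v

/-- The first canonical Hermitian connection `∇̄_X Y = ∇_X Y + η_X Y`. -/
def hermitianConnection : CovariantDerivative I E (TangentSpace I : M → Type _) :=
  g.leviCivita.addOneForm A.etaForm

/-- The torsion tensor `T_v w` of the canonical Hermitian connection. -/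
def torsion (x : M) (v w : TangentSpace I x) : TangentSpace I x :=
  A.hermitianConnection.torsion x v w

theorem torsion_eq (x : M) (v w : TangentSpace I x) :
    A.torsion x v w = A.eta x v w - A.eta x w v := by
  have h := congr($(g.leviCivita_torsion) x v w)
  rw [CovariantDerivative.torsion_apply_eq_extend] at h
  rw [torsion, CovariantDerivative.torsion_apply_eq_extend]
  simp only [FiberBundle.extend_apply_self] at h ⊢
  simp only [hermitianConnection, CovariantDerivative.addOneForm, add_apply,
    FiberBundle.extend_apply_self, eta]
  simp only [Pi.zero_apply, zero_apply] at h
  rw [← sub_eq_zero]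
  refine Eq.trans ?_ h
  abel

/-- The covariant derivative of `η` for the canonical Hermitian connection:
`(∇̄_v η)(Y, Z) = ∇̄_v(η_Y Z) - η_{∇̄_v Y} Z - η_Y (∇̄_v Z)` at `x`. -/
def nablaEta (x : M) (v : TangentSpace I x) (Y Z : (x : M) → TangentSpace I x) :
    TangentSpace I x :=
  A.hermitianConnection (fun y ↦ A.eta y (Y y) (Z y)) x v
    - A.eta x (A.hermitianConnection Y x v) (Z x)
    - A.eta x (Y x) (A.hermitianConnection Z x v)

/-- `∇̄_v η = 0` for the tangent vector `v` at `x`. -/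
def EtaParallelAlong (x : M) (v : TangentSpace I x) : Prop :=
  ∀ Y Z : (x : M) → TangentSpace I x, CMDiff ∞ (T% Y) → CMDiff ∞ (T% Z) → A.nablaEta x v Y Z = 0

/-- Quasi-Kähler: `(∇_{JX} J)(JY) = -(∇_X J)Y`. -/
def IsQuasiKahler : Prop :=
  ∀ (x : M) (v w : TangentSpace I x), A.nablaJ x (A.J x w) (A.J x v) = -A.nablaJ x w v

/-- The Kähler form `ω(X, Y) = g(JX, Y)`. -/
def omega (X Y : (x : M) → TangentSpace I x) (x : M) : ℝ := g.inner x (A.J x (X x)) (Y x)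

/-- Almost Kähler: the Kähler form is closed, that is, its exterior derivative vanishes on all
triples of smooth vector fields. -/
def IsAlmostKahler : Prop :=
  ∀ X Y Z : (x : M) → TangentSpace I x, CMDiff ∞ (T% X) → CMDiff ∞ (T% Y) → CMDiff ∞ (T% Z) →
    ∀ x : M,
      d% (A.omega Y Z) x (X x) - d% (A.omega X Z) x (Y x) + d% (A.omega X Y) x (Z x)
        - A.omega (VectorField.mlieBracket I X Y) Z x
        + A.omega (VectorField.mlieBracket I X Z) Y x
        - A.omega (VectorField.mlieBracket I Y Z) X x = 0

/-- The third Gray condition (the class `AH₃`): `R(JX, JY, JZ, JU) = R(X, Y, Z, U)`, where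
`R(X, Y, Z, U) = g(R(X, Y)Z, U)` is the Riemannian curvature. -/
def GrayThree : Prop :=
  ∀ X Y Z U : (x : M) → TangentSpace I x,
    CMDiff ∞ (T% X) → CMDiff ∞ (T% Y) → CMDiff ∞ (T% Z) → CMDiff ∞ (T% U) → ∀ x : M,
      g.inner x (g.curvature (fun y ↦ A.J y (X y)) (fun y ↦ A.J y (Y y))
          (fun y ↦ A.J y (Z y)) x) (A.J x (U x)) =
        g.inner x (g.curvature X Y Z x) (U x)

/-- The Kähler nullity at `x`: the tangent vectors `v` with `η_v = 0`. -/
def kahlerNullity (x : M) : Set (TangentSpace I x) := {v | ∀ w, A.eta x v w = 0}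

/-- The distribution `𝒱`: the orthogonal complement of the Kähler nullity at `x`. -/
def nullityOrthogonal (x : M) : Set (TangentSpace I x) :=
  {v | ∀ h ∈ A.kahlerNullity x, g.inner x v h = 0}

end AlmostComplex

end AlmostHermitian

end

/-!
The statement is reduced to algebra in the real vector space of smooth vector fields, on which
`∇̄`, `η` and `J` act by real multilinear operators; this needs only that `∇_X Y` is smooth
when `X` and `Y` are (`RiemMetric.contMDiff_leviCivita`), and that each tangent vector
extends to a smooth field.

For a quasi-Kähler structure `∇̄J = 0`, while `η_X J = -J η_X` and `η_{JX} = -J η_X`. Writing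
`∇ = ∇̄ - η`, the curvature of `∇` is
`R(X, Y) = R̄(X, Y) + ((∇̄_X η)_Y - (∇̄_Y η)_X + η_{T(X, Y)}) - [η_X, η_Y]`,
where the bracketed sum anticommutes with `J` and the other terms commute with it. Under the third
Gray condition `R(JX, JY) = J R(X, Y) J⁻¹`, so the anticommuting part changes sign under
`(X, Y) ↦ (JX, JY)` and the commuting part is invariant. The first fact makes
`(∇̄_X η)_Y - J (∇̄_{JX} η)_Y` symmetric in `X` and `Y`; being complex linear in `X` and
antilinear in `Y`, it vanishes, that is, `∇̄_{JX} η = -J ∇̄_X η` (`HermitianAlgebra.covE_J_left`).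
The second fact gives `R̄(JX, JY) = R̄(X, Y)` (`HermitianAlgebra.curvD_J_J`). In the Ricci
identity for `∇̄² η`, subtracting the instance at `(JX, JY)` from the one at `(X, Y)` therefore
removes the curvature.
What is left equates `-2 ∇̄_{T(X, Y)} η`, which is complex linear in `X`, with an expression that is
antilinear in `X`; so both vanish (`HermitianAlgebra.covE_tor`).

For an almost Kähler structure, the cyclic sum of `g((∇_X J)Y, Z)` vanishes. This implies that the
structure is quasi-Kähler and that `g(T_X Y, U) = -g(η_U X, Y)`, so a vector is orthogonal to the
image of `T` exactly if it lies in the Kähler nullity. Hence the image of `T` spans the distribution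
`𝒱` (`AlmostComplex.IsAlmostKahler.nullityOrthogonal_eq_span`), and `∇̄_v η = 0` is a linear
condition on `v`.
-/

noncomputable section

namespace AlmostHermitian

/-! ### The algebra of a Hermitian connection with torsion -/

namespace HermitianAlgebra

variable {𝔛 : Type*} [AddCommGroup 𝔛] [Module ℝ 𝔛]
  (D e : 𝔛 →ₗ[ℝ] 𝔛 →ₗ[ℝ] 𝔛) (J : 𝔛 →ₗ[ℝ] 𝔛)

/-- The bracket `[X, Y]` of the torsion-free connection `D - e`. -/
def bracket (X Y : 𝔛) : 𝔛 := (D X Y - e X Y) - (D Y X - e Y X)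

/-- The torsion of the connection `D`, expressed through the difference tensor `e`. -/
def tor (X Y : 𝔛) : 𝔛 := e X Y - e Y X

/-- The curvature `-[D_X, D_Y] + D_{[X, Y]}` of the connection `D`. -/
def curvD (X Y Z : 𝔛) : 𝔛 := -(D X (D Y Z) - D Y (D X Z)) + D (bracket D e X Y) Z

/-- The curvature `-[L_X, L_Y] + L_{[X, Y]}` of the torsion-free connection `L = D - e`. -/
def curvL (X Y Z : 𝔛) : 𝔛 :=
  -((D X (D Y Z - e Y Z) - e X (D Y Z - e Y Z)) - (D Y (D X Z - e X Z) - e Y (D X Z - e X Z)))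
    + (D (bracket D e X Y) Z - e (bracket D e X Y) Z)

/-- The covariant derivative `(D_V e)(Y, Z)`. -/
def covE (V Y Z : 𝔛) : 𝔛 := D V (e Y Z) - e (D V Y) Z - e Y (D V Z)

/-- The second covariant derivative `(D²_{X, V} e)(Y, Z)`. -/
def covE₂ (X V Y Z : 𝔛) : 𝔛 :=
  D X (covE D e V Y Z) - covE D e (D X V) Y Z - covE D e V (D X Y) Z - covE D e V Y (D X Z)

/-- Comparison of the two curvatures. If `D` commutes and `e` anticommutes with `J`, then the first
and the last term on the right commute with `J`, and the middle one anticommutes with it. -/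
theorem curvL_eq (X Y Z : 𝔛) :
    curvL D e X Y Z = curvD D e X Y Z + (covE D e X Y Z - covE D e Y X Z + e (tor e X Y) Z)
      - (e X (e Y Z) - e Y (e X Z)) := by
  simp only [curvL, curvD, covE, bracket, tor, map_sub, LinearMap.sub_apply]
  abel

/-- The Ricci identity for `e`. -/
theorem covE₂_sub_covE₂ (X V Y Z : 𝔛) :
    covE₂ D e X V Y Z - covE₂ D e V X Y Z = -covE D e (tor e X V) Y Z
      - (curvD D e X V (e Y Z) - e (curvD D e X V Y) Z - e Y (curvD D e X V Z)) := by
  simp only [covE₂, curvD, covE, bracket, tor, map_sub, map_neg, map_add, LinearMap.sub_apply,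
    LinearMap.neg_apply, LinearMap.add_apply]
  abel

variable {D e J}

section Hermitian

variable (hJ : ∀ X, J (J X) = -X) (hD : ∀ X Y, D X (J Y) = J (D X Y))
  (heJ : ∀ X Y, e X (J Y) = -J (e X Y)) (heJ' : ∀ X Y, e (J X) Y = -J (e X Y))

include hD heJ in
theorem covE_J_right (V Y Z : 𝔛) : covE D e V Y (J Z) = -J (covE D e V Y Z) := by
  simp only [covE, hD, heJ, map_sub, map_neg]
  abel

include hD heJ' in
theorem covE_J_mid (V Y Z : 𝔛) : covE D e V (J Y) Z = -J (covE D e V Y Z) := by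
  simp only [covE, hD, heJ', map_sub, map_neg]
  abel

include hD in
theorem curvD_J (X Y Z : 𝔛) : curvD D e X Y (J Z) = J (curvD D e X Y Z) := by
  simp only [curvD, hD, map_sub, map_neg, map_add]

include hJ heJ heJ' in
theorem tor_J_J (X Y : 𝔛) : tor e (J X) (J Y) = -tor e X Y := by
  simp only [tor, heJ, heJ', map_neg, hJ]
  abel

include heJ heJ' in
theorem tor_J_left (X Y : 𝔛) : tor e (J X) Y = -J (tor e X Y) := by
  simp only [tor, heJ, heJ', map_sub]
  abel

variable (hR : ∀ X Y Z, curvL D e (J X) (J Y) (J Z) = J (curvL D e X Y Z))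

include hJ hR in
theorem curvL_J_J (X Y Z : 𝔛) :
    curvL D e (J X) (J Y) Z = -J (curvL D e X Y (J Z)) := by
  rw [← hR, hJ]
  simp only [curvL, map_sub, map_neg]
  abel

include hJ hD heJ heJ' hR in
/-- The invariance of the curvature of `D`, from the parts of the curvature of `D - e` that commute
with `J`. -/
theorem curvD_J_J (X Y Z : 𝔛) : curvD D e (J X) (J Y) Z = curvD D e X Y Z := by
  have h1 := curvL_J_J hJ hR X Y Z
  have h2 := hR X Y Z
  have h3 := congrArg J h2
  simp only [curvL_eq, covE_J_right hD heJ, covE_J_mid hD heJ', curvD_J hD, heJ, heJ',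
    map_sub, map_neg, map_add, hJ, tor_J_J hJ heJ heJ', LinearMap.neg_apply] at h1 h3
  have : (2 : ℝ) • curvD D e (J X) (J Y) Z = (2 : ℝ) • curvD D e X Y Z := by
    linear_combination (norm := module) h1 - h3
  exact smul_right_injective 𝔛 (two_ne_zero (α := ℝ)) this

include hJ hD heJ heJ' hR in
/-- Comparing the parts of the curvature that anticommute with `J` shows that
`(D_X e)_Y - J (D_{JX} e)_Y` is symmetric in `X` and `Y`. It is complex linear in `X` and antilinear
in `Y`, so it vanishes. -/
theorem covE_J_left (X Y Z : 𝔛) : covE D e (J X) Y Z = -J (covE D e X Y Z) := by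
  have sym : ∀ X Y, covE D e X Y Z - J (covE D e (J X) Y Z)
      = covE D e Y X Z - J (covE D e (J Y) X Z) := by
    intro X Y
    have h1 := curvL_J_J hJ hR X Y Z
    have h3 := curvD_J_J hJ hD heJ heJ' hR X Y Z
    simp only [curvL_eq, covE_J_right hD heJ, covE_J_mid hD heJ', curvD_J hD, heJ, heJ', h3,
      map_sub, map_neg, map_add, hJ, tor_J_J hJ heJ heJ', LinearMap.neg_apply] at h1
    linear_combination (norm := module) h1
  have h1 := sym (J X) Y
  have h2 := congrArg J (sym X Y)
  simp only [hJ, map_neg, covE_J_mid hD heJ', map_sub, neg_neg] at h1 h2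
  have e1 : covE D e (-X) Y Z = -covE D e X Y Z := by simp [covE]; abel
  rw [e1] at h1
  simp only [map_neg] at h1
  have : (2 : ℝ) • covE D e (J X) Y Z = (2 : ℝ) • -J (covE D e X Y Z) := by
    linear_combination (norm := module) h1 + h2
  exact smul_right_injective 𝔛 (two_ne_zero (α := ℝ)) this

include hJ hD heJ heJ' hR in
/-- `D_{T(X, Y)} e = 0`: skew-symmetrizing `D² e` and using the invariance of the Hermitian
curvature leaves only the torsion term of the Ricci identity, whose behaviour under `J` is opposite
to that of the remaining terms. -/
theorem covE_tor (X V Y Z : 𝔛) : covE D e (tor e X V) Y Z = 0 := by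
  have hN := covE_J_left hJ hD heJ heJ' hR
  have hA : ∀ X V, covE₂ D e X (J V) Y Z = -J (covE₂ D e X V Y Z) := by
    intro X V
    simp only [covE₂, hN, hD, map_sub, map_neg]
    abel
  have hneg : ∀ X V, covE₂ D e (-X) V Y Z = -covE₂ D e X V Y Z := by
    intro X V
    simp only [covE₂, covE, map_neg, map_sub, LinearMap.neg_apply]
    abel
  have hneg' : ∀ X, covE D e (-X) Y Z = -covE D e X Y Z := by
    intro X
    simp only [covE, map_neg, LinearMap.neg_apply]
    abel
  have key : ∀ X V, (covE₂ D e X V Y Z + J (covE₂ D e (J X) V Y Z))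
      - (covE₂ D e V X Y Z + J (covE₂ D e (J V) X Y Z))
      = -((2 : ℝ) • covE D e (tor e X V) Y Z) := by
    intro X V
    have h1 := covE₂_sub_covE₂ D e X V Y Z
    have h2 := covE₂_sub_covE₂ D e (J X) (J V) Y Z
    simp only [curvD_J_J hJ hD heJ heJ' hR, hA, tor_J_J hJ heJ heJ', hneg'] at h2
    linear_combination (norm := module) h1 - h2
  have h1 := key (J X) V
  have h2 := congrArg J (key X V)
  simp only [tor_J_left heJ heJ', hJ, hneg, hneg', hN, hA, map_neg, map_sub, map_add, map_smul,
    neg_neg] at h1 h2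
  have h3 : (4 : ℝ) • J (covE D e (tor e X V) Y Z) = 0 := by
    linear_combination (norm := module) h1 + h2
  have h4 := congrArg J ((smul_eq_zero_iff_right (four_ne_zero (α := ℝ))).1 h3)
  simpa [hJ] using h4

end Hermitian

end HermitianAlgebra

/-! ### Smooth vector fields and smoothness of the Levi-Civita connection -/

/-- A matrix-valued function with smooth entries has smooth determinant. -/
theorem contMDiffAt_det {E : Type*} [NormedAddCommGroup E] [NormedSpace ℝ E]
    {M : Type*} [TopologicalSpace M] [ChartedSpace E M] {ι : Type*} [Fintype ι] [DecidableEq ι]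
    {x : M} {G : M → Matrix ι ι ℝ} (hG : ∀ i j, CMDiffAt ∞ (fun y ↦ G y i j) x) :
    CMDiffAt ∞ (fun y ↦ (G y).det) x := by
  simp only [Matrix.det_apply, Units.smul_def, zsmul_eq_mul]
  refine contMDiffAt_finsetSum fun σ _ ↦ contMDiffAt_const.mul ?_
  exact contMDiffAt_finsetProd fun i _ ↦ hG _ _

variable {E : Type*} [NormedAddCommGroup E] [NormedSpace ℝ E]
  {M : Type*} [TopologicalSpace M] [ChartedSpace E M] [IsManifold 𝓘(ℝ, E) ∞ M]

variable (E M) in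
/-- The smooth vector fields on `M`, as a real vector space. -/
abbrev SmoothField := Cₛ^∞⟮𝓘(ℝ, E); E, (TangentSpace 𝓘(ℝ, E) : M → Type _)⟯

/-- Every tangent vector is the value of a globally defined smooth vector field. -/
theorem exists_smoothField_apply_eq [FiniteDimensional ℝ E] [T2Space M] {x : M}
    (v : TangentSpace 𝓘(ℝ, E) x) :
    ∃ X : SmoothField E M, X x = v := by
  obtain ⟨s, hs, hsv⟩ := FiberBundle.exists_contMDiffOn_extend 𝓘(ℝ, E) E (k := ∞) v
  obtain ⟨u, hus, hu, hxu⟩ := mem_nhds_iff.1 hs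
  obtain ⟨f, hf⟩ :=
    ((SmoothBumpFunction.nhds_basis_tsupport (I := 𝓘(ℝ, E)) x).mem_iff.1 (hu.mem_nhds hxu))
  have hsm := ContMDiffOn.smul_section_of_tsupport (I := 𝓘(ℝ, E)) (n := ∞)
    f.contMDiff.contMDiffOn hu hf.2 (hsv.mono hus)
  refine ⟨⟨fun y ↦ f y • FiberBundle.extend E v y, hsm⟩, ?_⟩
  change f x • FiberBundle.extend E v x = v
  simp

theorem contMDiffAt_mvfderiv_apply {x : M} {f : M → ℝ} {X : (x : M) → TangentSpace 𝓘(ℝ, E) x}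
    (hf : CMDiffAt ∞ f x) (hX : CMDiffAt ∞ (T% X) x) :
    CMDiffAt ∞ (fun y ↦ d% f y (X y)) x := by
  have h1 := ContMDiffAt.mfderiv_const (m := ∞) hf le_rfl
  have h2 := ContMDiffAt.clm_apply_of_inCoordinates (b₁ := id) (b₂ := f) h1 hX hf
  rw [contMDiffAt_totalSpace] at h2
  have h3 := h2.2
  simp at h3
  exact h3

theorem contMDiffAt_mlieBracket [FiniteDimensional ℝ E] {x : M}
    {X Y : (x : M) → TangentSpace 𝓘(ℝ, E) x}
    (hX : CMDiffAt ∞ (T% X) x) (hY : CMDiffAt ∞ (T% Y) x) :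
    CMDiffAt ∞ (T% (VectorField.mlieBracket 𝓘(ℝ, E) X Y)) x := by
  have : IsManifold 𝓘(ℝ, E) (((⊤ : ℕ∞) : WithTop ℕ∞) + 1) M :=
    inferInstanceAs (IsManifold 𝓘(ℝ, E) ∞ M)
  have : IsManifold 𝓘(ℝ, E) (minSmoothness ℝ 2) M := by
    rw [minSmoothness_of_isRCLikeNormedField]
    infer_instance
  exact ContMDiffAt.mlieBracket_vectorField (m := ⊤) (n := ⊤) hX hY (by simp)

namespace RiemMetric

variable (g : RiemMetric 𝓘(ℝ, E) M)

theorem contMDiffAt_inner {x : M} {X Y : (x : M) → TangentSpace 𝓘(ℝ, E) x}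
    (hX : CMDiffAt ∞ (T% X) x) (hY : CMDiffAt ∞ (T% Y) x) :
    CMDiffAt ∞ (fun y ↦ g.inner y (X y) (Y y)) x := by
  have h : ContMDiffAt 𝓘(ℝ, E) (𝓘(ℝ, E).prod 𝓘(ℝ)) ∞
      (fun m ↦ TotalSpace.mk' ℝ (E := Bundle.Trivial M ℝ) m (g.inner m (X m) (Y m))) x :=
    ContMDiffAt.clm_bundle_apply₂ (F₁ := E) (F₂ := E) g.contMDiff.contMDiffAt hX hY
  rw [contMDiffAt_totalSpace] at h
  exact h.2

theorem contMDiffAt_koszul [FiniteDimensional ℝ E] {x : M}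
    {V S U : (x : M) → TangentSpace 𝓘(ℝ, E) x}
    (hV : CMDiffAt ∞ (T% V) x) (hS : CMDiffAt ∞ (T% S) x) (hU : CMDiffAt ∞ (T% U) x) :
    CMDiffAt ∞ (g.koszul V S U) x := by
  refine ContMDiffAt.sub (ContMDiffAt.sub (ContMDiffAt.add (ContMDiffAt.sub (ContMDiffAt.add
    (contMDiffAt_mvfderiv_apply (g.contMDiffAt_inner hS hU) hV)
    (contMDiffAt_mvfderiv_apply (g.contMDiffAt_inner hV hU) hS))
    (contMDiffAt_mvfderiv_apply (g.contMDiffAt_inner hV hS) hU))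
    (g.contMDiffAt_inner ?_ hU)) (g.contMDiffAt_inner ?_ hS)) (g.contMDiffAt_inner ?_ hV)
  · exact contMDiffAt_mlieBracket hV hS
  · exact contMDiffAt_mlieBracket hV hU
  · exact contMDiffAt_mlieBracket hS hU

/-- Vector fields whose inner products with the members of a smooth local frame are smooth are
smooth: by Cramer's rule, their components are rational functions of these inner products and the
entries of the Gram matrix of the frame. -/
theorem contMDiffAt_of_inner_frame [FiniteDimensional ℝ E] {x : M} {ι : Type*} [Fintype ι]
    (b : Module.Basis ι ℝ E)
    {W : (x : M) → TangentSpace 𝓘(ℝ, E) x}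
    (hW : ∀ i, CMDiffAt ∞ (fun y ↦ g.inner y (W y)
      ((trivializationAt E (TangentSpace 𝓘(ℝ, E)) x).localFrame b i y)) x) :
    CMDiffAt ∞ (T% W) x := by
  classical
  set t := trivializationAt E (TangentSpace 𝓘(ℝ, E) : M → Type _) x with ht
  have hx : x ∈ t.baseSet := FiberBundle.mem_baseSet_trivializationAt' x
  let G : M → Matrix ι ι ℝ := fun y i j ↦ g.inner y (t.localFrame b j y) (t.localFrame b i y)
  have hG : ∀ i j, CMDiffAt ∞ (fun y ↦ G y i j) x := fun i j ↦
    g.contMDiffAt_inner (contMDiffAt_localFrame_of_mem ∞ t b j hx)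
      (contMDiffAt_localFrame_of_mem ∞ t b i hx)
  let r : M → ι → ℝ := fun y i ↦ g.inner y (W y) (t.localFrame b i y)
  have hsum : ∀ y ∈ t.baseSet,
      W y = ∑ j, t.localFrameCoeff 𝓘(ℝ, E) b j y (W y) • t.localFrame b j y := fun y hy ↦
    t.eq_sum_localFrameCoeff_smul hy
  have hcoeff : ∀ y ∈ t.baseSet,
      (G y).mulVec (fun j ↦ t.localFrameCoeff 𝓘(ℝ, E) b j y (W y)) = r y := by
    intro y hy
    ext i
    change _ = g.inner y (W y) (t.localFrame b i y)
    conv_rhs => rw [hsum y hy]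
    simp [Matrix.mulVec, dotProduct, G, mul_comm]
  have hdet : ∀ y ∈ t.baseSet, (G y).det ≠ 0 := by
    intro y hy h0
    obtain ⟨c, hc0, hc⟩ := Matrix.exists_mulVec_eq_zero_iff.2 h0
    set v := ∑ j, c j • t.localFrame b j y with hv
    have hvi : ∀ i, g.inner y v (t.localFrame b i y) = 0 := by
      intro i
      have := congrFun hc i
      simpa [Matrix.mulVec, dotProduct, G, mul_comm, hv] using this
    have hvv : g.inner y v v = 0 := by
      have : g.inner y v v = ∑ i, c i * g.inner y v (t.localFrame b i y) := by
        conv_lhs => rw [hv, map_sum]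
        simp [← hv]
      rw [this]
      simp [hvi]
    have hv0 : v = 0 := by
      by_contra hne
      exact (g.pos y v hne).ne' hvv
    refine hc0 (funext fun j ↦ ?_)
    have hli := (t.isLocalFrameOn_localFrame_baseSet 𝓘(ℝ, E) ∞ b).linearIndependent hy
    exact Fintype.linearIndependent_iff.1 hli c hv0 j
  rw [contMDiffAt_iff_localFrameCoeff (I := 𝓘(ℝ, E)) b hx]
  intro j
  have hcr : ∀ y ∈ t.baseSet, t.localFrameCoeff 𝓘(ℝ, E) b j y (W y)
      = (G y).det⁻¹ * ((G y).updateCol j (r y)).det := by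
    intro y hy
    have h := congrFun ((G y).cramer_eq_adjugate_mulVec (r y)) j
    rw [← hcoeff y hy, Matrix.mulVec_mulVec, Matrix.adjugate_mul, Matrix.smul_mulVec,
      Matrix.one_mulVec, hcoeff y hy, Matrix.cramer_apply, Pi.smul_apply, smul_eq_mul] at h
    rw [h, inv_mul_cancel_left₀ (hdet y hy)]
  have hsm : CMDiffAt ∞ (fun y ↦ (G y).det⁻¹ * ((G y).updateCol j (r y)).det) x := by
    refine ContMDiffAt.mul ((contMDiffAt_det hG).inv₀ (hdet x hx)) (contMDiffAt_det fun i k ↦ ?_)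
    by_cases hk : k = j
    · simpa [Matrix.updateCol_apply, hk] using hW i
    · simpa [Matrix.updateCol_apply, hk] using hG i k
  refine hsm.congr_of_eventuallyEq ?_
  filter_upwards [t.open_baseSet.mem_nhds hx] with y hy using hcr y hy

variable [FiniteDimensional ℝ E]

/-- The Levi-Civita derivative of a smooth field along a smooth field is smooth. -/
theorem contMDiff_leviCivita {V S : (x : M) → TangentSpace 𝓘(ℝ, E) x}
    (hV : CMDiff ∞ (T% V)) (hS : CMDiff ∞ (T% S)) :
    CMDiff ∞ (T% (fun y ↦ g.leviCivita S y (V y))) := by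
  intro x
  set t := trivializationAt E (TangentSpace 𝓘(ℝ, E) : M → Type _) x with ht
  have hx : x ∈ t.baseSet := FiberBundle.mem_baseSet_trivializationAt' x
  refine g.contMDiffAt_of_inner_frame (Module.finBasis ℝ E) fun i ↦ ?_
  set U := t.localFrame (Module.finBasis ℝ E) i with hU
  have hUs : ∀ y ∈ t.baseSet, CMDiffAt ∞ (T% U) y := fun y hy ↦
    contMDiffAt_localFrame_of_mem ∞ t _ i hy
  have hk : CMDiffAt ∞ (fun y ↦ (1 / 2 : ℝ) * g.koszul V S U y) x :=
    contMDiffAt_const.mul (g.contMDiffAt_koszul (hV x) (hS x) (hUs x hx))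
  refine hk.congr_of_eventuallyEq ?_
  filter_upwards [t.open_baseSet.mem_nhds hx] with y hy
  rw [← g.two_inner_leviCivitaFun ((hV y).mdifferentiableAt (by simp))
    ((hS y).mdifferentiableAt (by simp)) ((hUs y hy).mdifferentiableAt (by simp))]
  change g.inner y (g.leviCivitaFun S y (V y)) (U y) = _
  ring

theorem leviCivita_sub_leviCivita {x : M} {X Y : (x : M) → TangentSpace 𝓘(ℝ, E) x}
    (hX : MDiffAt (T% X) x) (hY : MDiffAt (T% Y) x) :
    g.leviCivita Y x (X x) - g.leviCivita X x (Y x) = VectorField.mlieBracket 𝓘(ℝ, E) X Y x :=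
  (CovariantDerivative.torsion_eq_zero_iff _).1 g.leviCivita_torsion hX hY

end RiemMetric

/-! ### The intrinsic torsion and the Kähler nullity -/

namespace AlmostComplex

variable {g : RiemMetric 𝓘(ℝ, E) M} (A : AlmostComplex g)

theorem inner_J_left (x : M) (v w : TangentSpace 𝓘(ℝ, E) x) :
    g.inner x (A.J x v) w = -g.inner x v (A.J x w) := by
  rw [← A.isometry x v (A.J x w), A.sq]
  simp

theorem contMDiff_J {Y : (x : M) → TangentSpace 𝓘(ℝ, E) x} (hY : CMDiff ∞ (T% Y)) :
    CMDiff ∞ (T% (fun y ↦ A.J y (Y y))) :=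
  ContMDiff.clm_bundle_apply (F₁ := E) (F₂ := E) A.smooth hY

/-- The action of `J` on smooth vector fields. -/
def fieldJ : SmoothField E M →ₗ[ℝ] SmoothField E M where
  toFun X := ⟨fun y ↦ A.J y (X y), A.contMDiff_J X.contMDiff⟩
  map_add' X Y := by ext y; exact map_add (A.J y) (X y) (Y y)
  map_smul' c X := by ext y; exact map_smul (A.J y) c (X y)

@[simp] theorem fieldJ_apply (X : SmoothField E M) (x : M) : A.fieldJ X x = A.J x (X x) := rfl

theorem fieldJ_fieldJ (X : SmoothField E M) : A.fieldJ (A.fieldJ X) = -X := by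
  ext x
  exact A.sq x (X x)

variable [FiniteDimensional ℝ E]

theorem inner_ext {x : M} {u v : TangentSpace 𝓘(ℝ, E) x}
    (h : ∀ w, g.inner x u w = g.inner x v w) : u = v := by
  apply (g.flat x).injective
  ext w
  exact h w

theorem nablaJ_J (x : M) (w v : TangentSpace 𝓘(ℝ, E) x) :
    A.nablaJ x (A.J x w) v = -A.J x (A.nablaJ x w v) := by
  have hY := FiberBundle.mdifferentiableAt_extend 𝓘(ℝ, E) E w
  have h1 := A.nablaJ_apply (A.mdifferentiableAt_J hY) v
  have h2 := A.nablaJ_apply hY v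
  have e : (fun y ↦ A.J y (A.J y (FiberBundle.extend E w y))) =
      (-1 : ℝ) • FiberBundle.extend E w := by
    ext y
    simp [A.sq]
  have h3 := g.leviCivita.isCovariantDerivativeOn.smul_const (-1) hY (Set.mem_univ x)
  rw [e, h3] at h1
  simp only [FiberBundle.extend_apply_self] at h1 h2
  rw [h1, h2, map_sub, A.sq]
  simp
  abel

theorem inner_nablaJ_left (x : M) (w u v : TangentSpace 𝓘(ℝ, E) x) :
    g.inner x (A.nablaJ x w v) u = -g.inner x (A.nablaJ x u v) w := by
  have hW := FiberBundle.mdifferentiableAt_extend 𝓘(ℝ, E) E w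
  have hU := FiberBundle.mdifferentiableAt_extend 𝓘(ℝ, E) E u
  have h1 := A.nablaJ_apply hW v
  have h2 := A.nablaJ_apply hU v
  have m1 := g.leviCivita_metric (A.mdifferentiableAt_J hW) hU v
  have m2 := g.leviCivita_metric (A.mdifferentiableAt_J hU) hW v
  have e : (fun y ↦ g.inner y (A.J y (FiberBundle.extend E w y)) (FiberBundle.extend E u y)) =
      -fun y ↦ g.inner y (A.J y (FiberBundle.extend E u y)) (FiberBundle.extend E w y) := by
    ext y
    rw [A.inner_J_left, g.symm]
    rfl
  rw [e, mvfderiv_neg] at m1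
  simp only [FiberBundle.extend_apply_self, neg_apply] at h1 h2 m1 m2
  have s1 := A.inner_J_left x (g.leviCivita (FiberBundle.extend E w) x v) u
  have s2 := A.inner_J_left x (g.leviCivita (FiberBundle.extend E u) x v) w
  have s3 := g.symm x (A.J x u) (g.leviCivita (FiberBundle.extend E w) x v)
  have s4 := g.symm x (A.J x w) (g.leviCivita (FiberBundle.extend E u) x v)
  rw [h1, h2]
  simp only [map_sub, sub_apply]
  linarith

theorem eta_eq (x : M) (v w : TangentSpace 𝓘(ℝ, E) x) :
    A.eta x v w = (1 / 2 : ℝ) • A.nablaJ x (A.J x w) v := rfl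

theorem eta_J_right (x : M) (v w : TangentSpace 𝓘(ℝ, E) x) :
    A.eta x v (A.J x w) = -A.J x (A.eta x v w) := by
  rw [eta_eq, eta_eq, nablaJ_J, smul_neg, map_smul]

theorem eta_J_left {A : AlmostComplex g} (h : A.IsQuasiKahler) (x : M)
    (v w : TangentSpace 𝓘(ℝ, E) x) :
    A.eta x (A.J x v) w = -A.J x (A.eta x v w) := by
  rw [← eta_J_right, eta_eq, eta_eq, h, A.sq, map_neg, neg_apply]

theorem inner_eta_left (x : M) (v w u : TangentSpace 𝓘(ℝ, E) x) :
    g.inner x (A.eta x v w) u = -g.inner x (A.eta x v u) w := by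
  rw [eta_eq, eta_eq]
  simp only [map_smul, smul_apply, smul_eq_mul]
  rw [nablaJ_J, nablaJ_J, map_neg, map_neg, neg_apply, neg_apply, inner_J_left, inner_J_left,
    inner_nablaJ_left, nablaJ_J, map_neg, neg_apply, inner_J_left]
  ring

/-- For an almost Kähler structure the cyclic sum of `g((∇_X J)Y, Z)`, which is `dω(X, Y, Z)`,
vanishes. -/
theorem IsAlmostKahler.cyclic [T2Space M] {A : AlmostComplex g} (h : A.IsAlmostKahler) (x : M)
    (u v w : TangentSpace 𝓘(ℝ, E) x) :
    g.inner x (A.nablaJ x v u) w + g.inner x (A.nablaJ x w v) u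
      + g.inner x (A.nablaJ x u w) v = 0 := by
  obtain ⟨X, rfl⟩ := exists_smoothField_apply_eq u
  obtain ⟨Y, rfl⟩ := exists_smoothField_apply_eq v
  obtain ⟨Z, rfl⟩ := exists_smoothField_apply_eq w
  have hX : MDiffAt (T% (X : (x : M) → TangentSpace 𝓘(ℝ, E) x)) x := X.mdifferentiableAt
  have hY : MDiffAt (T% (Y : (x : M) → TangentSpace 𝓘(ℝ, E) x)) x := Y.mdifferentiableAt
  have hZ : MDiffAt (T% (Z : (x : M) → TangentSpace 𝓘(ℝ, E) x)) x := Z.mdifferentiableAt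
  have key := h X Y Z X.contMDiff Y.contMDiff Z.contMDiff x
  unfold omega at key
  rw [g.leviCivita_metric (A.mdifferentiableAt_J hY) hZ,
    g.leviCivita_metric (A.mdifferentiableAt_J hX) hZ,
    g.leviCivita_metric (A.mdifferentiableAt_J hX) hY,
    ← g.leviCivita_sub_leviCivita hX hY, ← g.leviCivita_sub_leviCivita hX hZ,
    ← g.leviCivita_sub_leviCivita hY hZ] at key
  have n1 := A.inner_nablaJ_left x (X x) (Z x) (Y x)
  rw [A.nablaJ_apply hX] at n1
  rw [A.nablaJ_apply hY, A.nablaJ_apply hX, ← neg_eq_iff_eq_neg.2 n1]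
  simp only [map_sub, sub_apply, A.inner_J_left] at key ⊢
  have s (a b : TangentSpace 𝓘(ℝ, E) x) :
      g.inner x a (A.J x b) = -g.inner x b (A.J x a) := by
    rw [g.symm, A.inner_J_left]
  have s1 := s (Y x) (g.leviCivita Z x (X x))
  have s2 := s (X x) (g.leviCivita Z x (Y x))
  have s3 := s (X x) (g.leviCivita Y x (Z x))
  linarith

theorem IsAlmostKahler.isQuasiKahler [T2Space M] {A : AlmostComplex g} (h : A.IsAlmostKahler) :
    A.IsQuasiKahler := by
  intro x v w
  -- for `c(u, v, w) = g((∇_{Ju} J)(Jv), w)`, closedness of `ω` at `(Ju, Jv, w)` expresses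
  -- `c(u, v, w) + c(v, w, u)` through `∇J`; the three cyclic instances determine `c`
  have hs : ∀ u v w : TangentSpace 𝓘(ℝ, E) x,
      g.inner x (A.nablaJ x (A.J x v) (A.J x u)) w
        + g.inner x (A.nablaJ x (A.J x w) (A.J x v)) u = g.inner x (A.nablaJ x u w) v := by
    intro u v w
    have h1 := h.cyclic x (A.J x u) (A.J x v) w
    have h2 : g.inner x (A.nablaJ x w (A.J x v)) (A.J x u)
        = g.inner x (A.nablaJ x (A.J x w) (A.J x v)) u := by
      rw [A.nablaJ_J, map_neg, neg_apply, A.inner_J_left, neg_neg]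
    have h3 : g.inner x (A.nablaJ x (A.J x u) w) (A.J x v)
        = -g.inner x (A.nablaJ x u w) v := by
      rw [A.nablaJ_J, map_neg, neg_apply, A.isometry]
    linarith
  refine inner_ext (g := g) fun u ↦ ?_
  have h1 := hs u v w
  have h2 := hs v w u
  have h3 := hs w u v
  have h4 := h.cyclic x u v w
  rw [map_neg, neg_apply]
  linarith

/-- For almost Kähler structures, `g(T_v w, u) = -g(η_u v, w)`. -/
theorem IsAlmostKahler.inner_torsion [T2Space M] {A : AlmostComplex g} (h : A.IsAlmostKahler)
    (x : M) (u v w : TangentSpace 𝓘(ℝ, E) x) :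
    g.inner x (A.torsion x v w) u = -g.inner x (A.eta x u v) w := by
  -- closedness of `ω` at `(Ju, v, w)` is the vanishing of the cyclic sum of `g(η_u v, w)`
  have h1 := h.isQuasiKahler x (A.J x u) v
  rw [A.sq, map_neg, neg_inj] at h1
  have h2 : g.inner x (A.nablaJ x w v) (A.J x u) = g.inner x (A.nablaJ x (A.J x w) v) u := by
    rw [A.nablaJ_J, map_neg, neg_apply, A.inner_J_left, neg_neg]
  have h3 := h.cyclic x (A.J x u) v w
  have h4 := A.inner_eta_left x w v u
  rw [A.torsion_eq, map_sub, sub_apply, h4]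
  simp only [eta_eq, map_smul, smul_apply, smul_eq_mul]
  rw [h1, ← h2]
  linarith

/-- A tangent vector is orthogonal to the image of the torsion if and only if it lies in the Kähler
nullity, so that image spans the orthogonal complement of the nullity. -/
theorem IsAlmostKahler.nullityOrthogonal_eq_span [T2Space M] {A : AlmostComplex g}
    (h : A.IsAlmostKahler) (x : M) :
    A.nullityOrthogonal x =
      Submodule.span ℝ {t | ∃ v w : TangentSpace 𝓘(ℝ, E) x, t = A.torsion x v w} := by
  refine Set.Subset.antisymm (fun v hv ↦ ?_) (fun v hv ↦ ?_)
  · by_contra hne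
    obtain ⟨f, hf, hspan⟩ := Submodule.exists_le_ker_of_notMem hne
    have : FiniteDimensional ℝ (TangentSpace 𝓘(ℝ, E) x) := inferInstanceAs (FiniteDimensional ℝ E)
    have : T2Space (TangentSpace 𝓘(ℝ, E) x) := inferInstanceAs (T2Space E)
    -- a functional vanishing on the span but not at `v` is the inner product with some `u`
    obtain ⟨u, hu⟩ := (g.flat x).surjective (LinearMap.toContinuousLinearMap f)
    have hu' : ∀ t, g.inner x u t = f t := fun t ↦ congr($hu t)
    refine hf ?_
    rw [← hu', g.symm]
    refine hv u fun a ↦ inner_ext (g := g) fun b ↦ ?_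
    have ht := LinearMap.mem_ker.1 (hspan (Submodule.subset_span ⟨a, b, rfl⟩))
    rw [← hu', g.symm, h.inner_torsion, neg_eq_zero] at ht
    simpa using ht
  · intro u hu
    induction hv using Submodule.span_induction with
    | mem t ht =>
      obtain ⟨a, b, rfl⟩ := ht
      rw [h.inner_torsion, hu]
      simp
    | zero => simp
    | add a b _ _ ha hb => simp [ha, hb]
    | smul c a _ ha => simp [ha]

/-! ### The Hermitian connection on smooth vector fields -/

theorem contMDiff_eta {X Y : (x : M) → TangentSpace 𝓘(ℝ, E) x}
    (hX : CMDiff ∞ (T% X)) (hY : CMDiff ∞ (T% Y)) :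
    CMDiff ∞ (T% (fun y ↦ A.eta y (X y) (Y y))) := by
  have hJ := A.contMDiff_J hY
  have h := ((g.contMDiff_leviCivita hX (A.contMDiff_J hJ)).sub_section
    (A.contMDiff_J (g.contMDiff_leviCivita hX hJ))).const_smul_section (a := (1 / 2 : ℝ))
  convert h using 3 with y
  rw [eta_eq, A.nablaJ_apply ((hJ y).mdifferentiableAt (by simp))]
  rfl

/-- The operation `(X, Y) ↦ η_X Y` on smooth vector fields. -/
def fieldEta : SmoothField E M →ₗ[ℝ] SmoothField E M →ₗ[ℝ] SmoothField E M :=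
  LinearMap.mk₂ ℝ (fun X Y ↦ ⟨fun y ↦ A.eta y (X y) (Y y), A.contMDiff_eta X.contMDiff Y.contMDiff⟩)
    (fun X X' Y ↦ by ext y; exact map_add (A.etaForm y (Y y)) (X y) (X' y))
    (fun c X Y ↦ by ext y; exact map_smul (A.etaForm y (Y y)) c (X y))
    (fun X Y Y' ↦ by ext y; exact congr($(map_add (A.etaForm y) (Y y) (Y' y)) (X y)))
    (fun c X Y ↦ by ext y; exact congr($(map_smul (A.etaForm y) c (Y y)) (X y)))

/-- The operation `(X, Y) ↦ ∇̄_X Y` on smooth vector fields. -/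
def fieldNabla : SmoothField E M →ₗ[ℝ] SmoothField E M →ₗ[ℝ] SmoothField E M :=
  LinearMap.mk₂ ℝ
    (fun X Y ↦ ⟨fun y ↦ A.hermitianConnection Y y (X y),
      (g.contMDiff_leviCivita X.contMDiff Y.contMDiff).add_section
        (A.contMDiff_eta X.contMDiff Y.contMDiff)⟩)
    (fun X X' Y ↦ by ext y; exact map_add (A.hermitianConnection Y y) (X y) (X' y))
    (fun c X Y ↦ by ext y; exact map_smul (A.hermitianConnection Y y) c (X y))
    (fun X Y Y' ↦ by
      ext y
      exact congr($(A.hermitianConnection.isCovariantDerivativeOn.add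
        Y.mdifferentiableAt Y'.mdifferentiableAt (Set.mem_univ y)) (X y)))
    (fun c X Y ↦ by
      ext y
      exact congr($(A.hermitianConnection.isCovariantDerivativeOn.smul_const c
        Y.mdifferentiableAt (Set.mem_univ y)) (X y)))

theorem coe_fieldNabla_sub_fieldEta (X Y : SmoothField E M) :
    ⇑(A.fieldNabla X Y - A.fieldEta X Y) = fun y ↦ g.leviCivita Y y (X y) := by
  ext y
  exact add_sub_cancel_right (g.leviCivita Y y (X y)) (A.eta y (X y) (Y y))

theorem fieldNabla_sub_fieldEta_apply (X Y : SmoothField E M) (x : M) :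
    A.fieldNabla X Y x - A.fieldEta X Y x = g.leviCivita Y x (X x) :=
  congrFun (A.coe_fieldNabla_sub_fieldEta X Y) x

/-- The connection `∇̄` is Hermitian: `∇̄ J = 0`. -/
theorem fieldNabla_fieldJ (X Y : SmoothField E M) :
    A.fieldNabla X (A.fieldJ Y) = A.fieldJ (A.fieldNabla X Y) := by
  ext x
  have h := A.nablaJ_apply (Y.mdifferentiableAt (x := x)) (X x)
  have h1 : A.eta x (X x) (A.J x (Y x)) = -(1 / 2 : ℝ) • A.nablaJ x (Y x) (X x) := by
    rw [eta_eq, A.sq]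
    simp
  have h2 : A.J x (A.eta x (X x) (Y x)) = (1 / 2 : ℝ) • A.nablaJ x (Y x) (X x) := by
    rw [← neg_eq_iff_eq_neg.2 (A.eta_J_right x (X x) (Y x)), h1]
    simp
  change g.leviCivita (fun y ↦ A.J y (Y y)) x (X x) + A.eta x (X x) (A.J x (Y x))
    = A.J x (g.leviCivita Y x (X x) + A.eta x (X x) (Y x))
  rw [map_add, h1, h2]
  linear_combination (norm := module) -h

theorem bracket_apply (X Y : SmoothField E M) (x : M) :
    HermitianAlgebra.bracket A.fieldNabla A.fieldEta X Y x
      = VectorField.mlieBracket 𝓘(ℝ, E) X Y x := by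
  rw [← g.leviCivita_sub_leviCivita X.mdifferentiableAt Y.mdifferentiableAt]
  simp only [← fieldNabla_sub_fieldEta_apply A]
  rfl

theorem curvL_apply (X Y Z : SmoothField E M) (x : M) :
    HermitianAlgebra.curvL A.fieldNabla A.fieldEta X Y Z x = g.curvature X Y Z x := by
  have h1 := A.fieldNabla_sub_fieldEta_apply X (A.fieldNabla Y Z - A.fieldEta Y Z) x
  have h2 := A.fieldNabla_sub_fieldEta_apply Y (A.fieldNabla X Z - A.fieldEta X Z) x
  have h3 := A.fieldNabla_sub_fieldEta_apply
    (HermitianAlgebra.bracket A.fieldNabla A.fieldEta X Y) Z x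
  rw [coe_fieldNabla_sub_fieldEta] at h1 h2
  rw [bracket_apply] at h3
  rw [RiemMetric.curvature, ← h1, ← h2, ← h3]
  rfl

/-- The third Gray condition as an identity between operators on smooth vector fields. -/
theorem curvL_fieldJ {A : AlmostComplex g} [T2Space M] (hA : A.GrayThree)
    (X Y Z : SmoothField E M) :
    HermitianAlgebra.curvL A.fieldNabla A.fieldEta (A.fieldJ X) (A.fieldJ Y) (A.fieldJ Z)
      = A.fieldJ (HermitianAlgebra.curvL A.fieldNabla A.fieldEta X Y Z) := by
  ext x
  refine inner_ext (g := g) fun u ↦ ?_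
  -- the third Gray condition is tested against `U` with `J U = u` at `x`
  obtain ⟨U, hU⟩ := exists_smoothField_apply_eq (-(A.J x u))
  have h := hA X Y Z U X.contMDiff Y.contMDiff Z.contMDiff U.contMDiff x
  rw [hU, map_neg, A.sq, neg_neg] at h
  rw [fieldJ_apply, curvL_apply, curvL_apply, A.inner_J_left, ← map_neg]
  exact h

/-- Here the fields `Y`, `Z` are unbundled, as in the definition of `EtaParallelAlong`. -/
theorem covE_apply (V : SmoothField E M) {Y Z : (x : M) → TangentSpace 𝓘(ℝ, E) x}
    (hY : CMDiff ∞ (T% Y)) (hZ : CMDiff ∞ (T% Z)) (x : M) :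
    HermitianAlgebra.covE A.fieldNabla A.fieldEta V ⟨Y, hY⟩ ⟨Z, hZ⟩ x
      = A.nablaEta x (V x) Y Z := rfl

theorem etaParallelAlong_torsion [T2Space M] {A : AlmostComplex g} (hQ : A.IsQuasiKahler)
    (hA : A.GrayThree) (x : M) (v w : TangentSpace 𝓘(ℝ, E) x) :
    A.EtaParallelAlong x (A.torsion x v w) := by
  intro Y Z hY hZ
  obtain ⟨X, rfl⟩ := exists_smoothField_apply_eq v
  obtain ⟨V, rfl⟩ := exists_smoothField_apply_eq w
  have h := HermitianAlgebra.covE_tor (D := A.fieldNabla) (e := A.fieldEta) (J := A.fieldJ)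
    A.fieldJ_fieldJ A.fieldNabla_fieldJ
    (fun X Y ↦ by ext y; exact A.eta_J_right y (X y) (Y y))
    (fun X Y ↦ by ext y; exact eta_J_left hQ y (X y) (Y y))
    (curvL_fieldJ hA) X V ⟨Y, hY⟩ ⟨Z, hZ⟩
  have hx := DFunLike.congr_fun h x
  rw [covE_apply] at hx
  rw [torsion_eq]
  exact hx

/-- The condition `∇̄_v η = 0` is linear in `v`. -/
def etaParallelSubmodule (x : M) : Submodule ℝ (TangentSpace 𝓘(ℝ, E) x) where
  carrier := {v | A.EtaParallelAlong x v}
  zero_mem' Y Z _ _ := by simp [nablaEta, eta]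
  add_mem' {v w} hv hw Y Z hY hZ := by
    have h : A.nablaEta x (v + w) Y Z = A.nablaEta x v Y Z + A.nablaEta x w Y Z := by
      simp only [nablaEta, eta, map_add, add_apply]
      abel
    rw [h, hv Y Z hY hZ, hw Y Z hY hZ, add_zero]
  smul_mem' c v hv Y Z hY hZ := by
    have h : A.nablaEta x (c • v) Y Z = c • A.nablaEta x v Y Z := by
      simp only [nablaEta, eta, map_smul, smul_apply]
      module
    rw [h, hv Y Z hY hZ, smul_zero]

theorem IsAlmostKahler.etaParallelAlong_iff [T2Space M] {A : AlmostComplex g}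
    (h : A.IsAlmostKahler) (x : M) :
    (∀ v w : TangentSpace 𝓘(ℝ, E) x, A.EtaParallelAlong x (A.torsion x v w)) ↔
      ∀ v ∈ A.nullityOrthogonal x, A.EtaParallelAlong x v := by
  rw [h.nullityOrthogonal_eq_span x]
  constructor
  · intro hT
    refine Submodule.span_le (p := A.etaParallelSubmodule x).2 ?_
    rintro _ ⟨v, w, rfl⟩
    exact hT v w
  · exact fun hV v w ↦ hV _ (Submodule.subset_span ⟨v, w, rfl⟩)

end AlmostComplex

end AlmostHermitian

end

theorem proposition3p2 {E : Type*} [NormedAddCommGroup E] [NormedSpace ℝ E] [FiniteDimensional ℝ E]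
    {M : Type*} [TopologicalSpace M] [T2Space M] [ChartedSpace E M] [IsManifold 𝓘(ℝ, E) ∞ M]
    (g : AlmostHermitian.RiemMetric 𝓘(ℝ, E) M) (A : AlmostHermitian.AlmostComplex g) :
    (A.IsQuasiKahler → A.GrayThree →
      ∀ (x : M) (v w : TangentSpace 𝓘(ℝ, E) x), A.EtaParallelAlong x (A.torsion x v w)) ∧
    (A.IsAlmostKahler → ∀ x : M,
      ((∀ v w : TangentSpace 𝓘(ℝ, E) x, A.EtaParallelAlong x (A.torsion x v w)) ↔
        ∀ v ∈ A.nullityOrthogonal x, A.EtaParallelAlong x v)) ∧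
    (A.IsAlmostKahler → A.GrayThree →
      ∀ (x : M), ∀ v ∈ A.nullityOrthogonal x, A.EtaParallelAlong x v) :=
  ⟨fun hQ hA ↦ AlmostHermitian.AlmostComplex.etaParallelAlong_torsion hQ hA,
    fun hK ↦ hK.etaParallelAlong_iff,
    fun hK hA x ↦ (hK.etaParallelAlong_iff x).1
      (AlmostHermitian.AlmostComplex.etaParallelAlong_torsion hK.isQuasiKahler hA x)⟩
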